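/- Let $A=\{a,b,c\}$, $B=\{0,1\}$, $S=\{1,2,3\}$. A circular word $[u]$ is the class of a finite word $u$ under conjugacy ($xy\sim yx$). A factor of $[u]$ is a factor (contiguous subword) of some conjugate of $u$, and $[u]$ is square-free if no factor of it has the form $xx$ with $x$ non-empty. A circular word over $A$ is level if the numbers of occurrences of any two letters of $A$ in it differ by at most $1$. If $z=z_1z_2\cdots z_n$ is a word over $A$ with $n\ge 2$ such that $[z]$ has no factor $xx$ with $x\in A$, then the circular Pansiot encoding of $[z]$ is the circular word $[u_1u_2\cdots u_n]$ over $B$, where $u_i=0$ if $z_i=z_{i+2}$ and $u_i=1$ otherwise (indices modulo $n$); a binary word $u$ encodes $[z]$ if $[u]$ is the circular Pansiot encoding of $[z]$. A binary word encodes at most one circular word over $A$, up to permutation of the alphabet $A$. Let $f:S^*\to B^*$ and $h:A^*\to S^*$ be the morphisms with $$f(1)=01,\quad f(2)=011,\quad f(3)=0111,\qquad h(a)=123123,\quad h(b)=132132,\quad h(c)=131313.$$ **Corollary.** Let $[v]$ be a circular square-free word over $A$ such that $v$ has prefix $a$ and suffix $b$. Let $w=h(v)$, and let $s$ be one of the $54$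 words listed below. Then $f(ws)$ encodes a level circular square-free word over $A$ of length $|f(w)|+|f(s)|$. That is, $f(ws)$ encodes some circular word over $A$, and every circular word over $A$ that it encodes is level, square-free, and of length $|f(w)|+|f(s)|$. The words $s$ (with $|f(s)|=54,55,\dots,107$, in this order) are $$\begin{aligned} &331313123231212122, 331313232321212122, 331232323231212122,\\ &33131312121231212122, 331323232321313122, 33123232132121212122,\\ &33123123213231212122, 33131323231231212122, 33132323123231212122,\\ &33131323232312132122, 33132323231232132122, 33132323231313232122,\\ &3312321313123231212122, 3312323232313121212122, 3312323213232321212122,\\ &3312312323231232132122, 3312323232313132132122, 3312323232312132323122,\\ &331212323123213231212122, 331212323131323231212122, 331212323123213232312122,\\ &331212323232132321313122, 331212323213132323232122, 331212323232132323232122,\\ &331232313132323232313122, 331313232323123232323122, 33121212323232321323212122,\\ &33121212313132323232313122, 33121213232323231313232122, 33121213232323123232323122,\\ &33123123232321323232313122, 33123123232323213232323122, 3312121212323232312132323122,\\ &3312121232323232132321313122, 3312121232323213132323232122, 3312121232323232132323232122,\\ &3312123232313132323232313122, 3312132323232132323232313122, 3312323213232323123232323122,\\ &331212121232313132323232313122,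 331212121313232323123232323122, 331212123232323213232132323122,\\ &331212132323232313123232323122, 331212323123232323213232323122, 331231232323232132323232313122,\\ &33121212123123232321323232313122, 33121212123123232323213232323122, 33121212312323232321323232313122,\\ &33121212323232313132323232313122, 33121232312323232313132323232122, 33121232323213232323123232323122,\\ &33123232132323232313123232323122, 33123232323123232323213232323122, 3312121212323213232323123232323122. \end{aligned}$$ -/

import Mathlib

namespace LevelWords

/-! ## Alphabets -/

/-- The ternary alphabet `A = {a, b, c}`. -/
inductive A where
  | a | b | c
  deriving DecidableEq

/-- The alphabet `S = {1, 2, 3}`. -/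
inductive S where
  | one | two | three
  deriving DecidableEq

instance : OfNat S 1 := ⟨S.one⟩
instance : OfNat S 2 := ⟨S.two⟩
instance : OfNat S 3 := ⟨S.three⟩

/-- The binary alphabet `B = {0, 1}`. -/
abbrev B : Type := Fin 2

/-! ## Circular words

Words over `α` are lists, and circular words are elements of `Cycle α`, the quotient of `List α`
by conjugacy (rotation). -/

/-- `u` is a factor of the circular word `Z`: it is a factor of some representative of `Z`. -/
def IsCircularFactor {α : Type*} (u : List α) (Z : Cycle α) : Prop :=
  ∃ w : List α, (w : Cycle α) = Z ∧ u <:+: w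

/-- A circular word is square-free if none of its factors is a square `xx` with `x` non-empty. -/
def CircularSquareFree {α : Type*} (Z : Cycle α) : Prop :=
  ∀ x : List α, x ≠ [] → ¬ IsCircularFactor (x ++ x) Z

/-- A circular ternary word is level if the numbers of occurrences of any two letters of `A`
differ by at most one. -/
def IsLevel (Z : Cycle A) : Prop :=
  ∀ x y : A, Z.toMultiset.count y ≤ Z.toMultiset.count x + 1

/-! ## Circular Pansiot encodings -/

/-- The word `u₁ ⋯ uₙ` with `uᵢ = 0` if `zᵢ = zᵢ₊₂` and `uᵢ = 1` otherwise, for `z = z₁ ⋯ zₙ`,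
with indices taken modulo `n`. -/
def pansiotWord (z : List A) : List B :=
  List.ofFn fun i : Fin z.length =>
    if z.get i = z.get ⟨(i + 2) % z.length, Nat.mod_lt _ i.pos⟩ then 0 else 1

/-- `U` is the circular Pansiot encoding of the circular ternary word `Z`, which has length at
least two and has no square of length two as a factor. -/
def IsCircularPansiotEncoding (U : Cycle B) (Z : Cycle A) : Prop :=
  2 ≤ Z.length ∧ (∀ x : A, ¬ IsCircularFactor [x, x] Z) ∧
    ∃ z : List A, (z : Cycle A) = Z ∧ U = (pansiotWord z : Cycle B)

/-! ## The morphisms `f` and `h` -/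

/-- The images of the letters under `f`. -/
def fLetter : S → List B
  | S.one => [0, 1]
  | S.two => [0, 1, 1]
  | S.three => [0, 1, 1, 1]

/-- The morphism `f : S* → B*` with `f(n) = 01ⁿ`. -/
def f (u : List S) : List B := u.flatMap fLetter

/-- The images of the letters under `h`. -/
def hLetter : A → List S
  | A.a => [1, 2, 3, 1, 2, 3]
  | A.b => [1, 3, 2, 1, 3, 2]
  | A.c => [1, 3, 1, 3, 1, 3]

/-- The morphism `h : A* → S*`. -/
def h (v : List A) : List S := v.flatMap hLetter

/-- The table of linking words `s`, in order of increasing length `54, 55, …, 107` of `f s`. -/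
def linkingWords : List (List S) :=
  [[3,3,1,3,1,3,1,2,3,2,3,1,2,1,2,1,2,2],
   [3,3,1,3,1,3,2,3,2,3,2,1,2,1,2,1,2,2],
   [3,3,1,2,3,2,3,2,3,2,3,1,2,1,2,1,2,2],
   [3,3,1,3,1,3,1,2,1,2,1,2,3,1,2,1,2,1,2,2],
   [3,3,1,3,2,3,2,3,2,3,2,1,3,1,3,1,2,2],
   [3,3,1,2,3,2,3,2,1,3,2,1,2,1,2,1,2,1,2,2],
   [3,3,1,2,3,1,2,3,2,1,3,2,3,1,2,1,2,1,2,2],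
   [3,3,1,3,1,3,2,3,2,3,1,2,3,1,2,1,2,1,2,2],
   [3,3,1,3,2,3,2,3,1,2,3,2,3,1,2,1,2,1,2,2],
   [3,3,1,3,1,3,2,3,2,3,2,3,1,2,1,3,2,1,2,2],
   [3,3,1,3,2,3,2,3,2,3,1,2,3,2,1,3,2,1,2,2],
   [3,3,1,3,2,3,2,3,2,3,1,3,1,3,2,3,2,1,2,2],
   [3,3,1,2,3,2,1,3,1,3,1,2,3,2,3,1,2,1,2,1,2,2],
   [3,3,1,2,3,2,3,2,3,2,3,1,3,1,2,1,2,1,2,1,2,2],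
   [3,3,1,2,3,2,3,2,1,3,2,3,2,3,2,1,2,1,2,1,2,2],
   [3,3,1,2,3,1,2,3,2,3,2,3,1,2,3,2,1,3,2,1,2,2],
   [3,3,1,2,3,2,3,2,3,2,3,1,3,1,3,2,1,3,2,1,2,2],
   [3,3,1,2,3,2,3,2,3,2,3,1,2,1,3,2,3,2,3,1,2,2],
   [3,3,1,2,1,2,3,2,3,1,2,3,2,1,3,2,3,1,2,1,2,1,2,2],
   [3,3,1,2,1,2,3,2,3,1,3,1,3,2,3,2,3,1,2,1,2,1,2,2],
   [3,3,1,2,1,2,3,2,3,1,2,3,2,1,3,2,3,2,3,1,2,1,2,2],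
   [3,3,1,2,1,2,3,2,3,2,3,2,1,3,2,3,2,1,3,1,3,1,2,2],
   [3,3,1,2,1,2,3,2,3,2,1,3,1,3,2,3,2,3,2,3,2,1,2,2],
   [3,3,1,2,1,2,3,2,3,2,3,2,1,3,2,3,2,3,2,3,2,1,2,2],
   [3,3,1,2,3,2,3,1,3,1,3,2,3,2,3,2,3,2,3,1,3,1,2,2],
   [3,3,1,3,1,3,2,3,2,3,2,3,1,2,3,2,3,2,3,2,3,1,2,2],
   [3,3,1,2,1,2,1,2,3,2,3,2,3,2,3,2,1,3,2,3,2,1,2,1,2,2],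
   [3,3,1,2,1,2,1,2,3,1,3,1,3,2,3,2,3,2,3,2,3,1,3,1,2,2],
   [3,3,1,2,1,2,1,3,2,3,2,3,2,3,2,3,1,3,1,3,2,3,2,1,2,2],
   [3,3,1,2,1,2,1,3,2,3,2,3,2,3,1,2,3,2,3,2,3,2,3,1,2,2],
   [3,3,1,2,3,1,2,3,2,3,2,3,2,1,3,2,3,2,3,2,3,1,3,1,2,2],
   [3,3,1,2,3,1,2,3,2,3,2,3,2,3,2,1,3,2,3,2,3,2,3,1,2,2],
   [3,3,1,2,1,2,1,2,1,2,3,2,3,2,3,2,3,1,2,1,3,2,3,2,3,1,2,2],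
   [3,3,1,2,1,2,1,2,3,2,3,2,3,2,3,2,1,3,2,3,2,1,3,1,3,1,2,2],
   [3,3,1,2,1,2,1,2,3,2,3,2,3,2,1,3,1,3,2,3,2,3,2,3,2,1,2,2],
   [3,3,1,2,1,2,1,2,3,2,3,2,3,2,3,2,1,3,2,3,2,3,2,3,2,1,2,2],
   [3,3,1,2,1,2,3,2,3,2,3,1,3,1,3,2,3,2,3,2,3,2,3,1,3,1,2,2],
   [3,3,1,2,1,3,2,3,2,3,2,3,2,1,3,2,3,2,3,2,3,2,3,1,3,1,2,2],
   [3,3,1,2,3,2,3,2,1,3,2,3,2,3,2,3,1,2,3,2,3,2,3,2,3,1,2,2],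
   [3,3,1,2,1,2,1,2,1,2,3,2,3,1,3,1,3,2,3,2,3,2,3,2,3,1,3,1,2,2],
   [3,3,1,2,1,2,1,2,1,3,1,3,2,3,2,3,2,3,1,2,3,2,3,2,3,2,3,1,2,2],
   [3,3,1,2,1,2,1,2,3,2,3,2,3,2,3,2,1,3,2,3,2,1,3,2,3,2,3,1,2,2],
   [3,3,1,2,1,2,1,3,2,3,2,3,2,3,2,3,1,3,1,2,3,2,3,2,3,2,3,1,2,2],
   [3,3,1,2,1,2,3,2,3,1,2,3,2,3,2,3,2,3,2,1,3,2,3,2,3,2,3,1,2,2],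
   [3,3,1,2,3,1,2,3,2,3,2,3,2,3,2,1,3,2,3,2,3,2,3,2,3,1,3,1,2,2],
   [3,3,1,2,1,2,1,2,1,2,3,1,2,3,2,3,2,3,2,1,3,2,3,2,3,2,3,1,3,1,2,2],
   [3,3,1,2,1,2,1,2,1,2,3,1,2,3,2,3,2,3,2,3,2,1,3,2,3,2,3,2,3,1,2,2],
   [3,3,1,2,1,2,1,2,3,1,2,3,2,3,2,3,2,3,2,1,3,2,3,2,3,2,3,1,3,1,2,2],
   [3,3,1,2,1,2,1,2,3,2,3,2,3,2,3,1,3,1,3,2,3,2,3,2,3,2,3,1,3,1,2,2],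
   [3,3,1,2,1,2,3,2,3,1,2,3,2,3,2,3,2,3,1,3,1,3,2,3,2,3,2,3,2,1,2,2],
   [3,3,1,2,1,2,3,2,3,2,3,2,1,3,2,3,2,3,2,3,1,2,3,2,3,2,3,2,3,1,2,2],
   [3,3,1,2,3,2,3,2,1,3,2,3,2,3,2,3,2,3,1,3,1,2,3,2,3,2,3,2,3,1,2,2],
   [3,3,1,2,3,2,3,2,3,2,3,1,2,3,2,3,2,3,2,3,2,1,3,2,3,2,3,2,3,1,2,2],
   [3,3,1,2,1,2,1,2,1,2,3,2,3,2,1,3,2,3,2,3,2,3,1,2,3,2,3,2,3,2,3,1,2,2]]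

end LevelWords

namespace LevelWords

/-! ### Decoding binary words -/

/-! Decoding `f (h x)` from the letters `a b` gives a block `g x` of 18 letters, six of each kind,
and ends at `a b` again; each `f s` also returns to `a b`. So `f (h v ++ s)` encodes the circular
word `v.flatMap g ++ link s`, and any other word it encodes is a renaming of this one. Levelness is
inherited from `link s`.

Square-freeness is proved for the two-sided periodic word, for squares no longer than one period `o
+ 18 * n`. Two markers, one at each end of the linking word, occur only once per period. A square
containing a marker has its centre inside that marker, since otherwise a half would copy it
elsewhere; so no square contains both. Squares reaching far enough into the linking word thus lie in
a bounded window, checked by computation, or would repeat a neighbouring context inside the linking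
word (`seg_ne_of_meets`).

The other squares lie among the blocks and a few letters on either side (`seg_ne_of_outer`). Short
ones are excluded by computation on a few blocks. In long ones `aba`, which marks block starts,
forces the half-length to be a multiple of 18, and reading one letter per block gives a square in
`v`. -/

/-- The letter of `A` different from `x` and `y`, if `x ≠ y`. -/
def third : A → A → A
  | A.a, A.b => A.c
  | A.b, A.a => A.c
  | A.a, A.c => A.b
  | A.c, A.a => A.b
  | A.b, A.c => A.a
  | A.c, A.b => A.a
  | x, _ => x

/-- The letter which follows `x y` in a word whose Pansiot encoding has the letter `u` there. -/
def next (x y : A) (u : B) : A := if u = 0 then x else third x y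

/-- The ternary word with first letters `x y` and Pansiot encoding `u`, without its last two
letters. -/
def decode : A → A → List B → List A
  | _, _, [] => []
  | x, y, u :: us => x :: decode y (next x y u) us

/-- The last two letters of the ternary word with first letters `x y` and Pansiot encoding `u`. -/
def decodeEnd : A → A → List B → A × A
  | x, y, [] => (x, y)
  | x, y, u :: us => decodeEnd y (next x y u) us

/-- The decodings of the words `f (h x)`. -/
def g : A → List A
  | A.a => [.a, .b, .a, .c, .a, .b, .c, .b, .a, .c, .b, .c, .a, .c, .b, .a, .b, .c]
  | A.b => [.a, .b, .a, .c, .a, .b, .c, .a, .c, .b, .a, .b, .c, .b, .a, .c, .b, .c]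
  | A.c => [.a, .b, .a, .c, .a, .b, .c, .a, .c, .b, .c, .a, .b, .c, .b, .a, .b, .c]

/-- The decoding of `f s`. -/
def link (s : List S) : List A := decode A.a A.b (f s)

/-! ### Words as numbers in base four -/

def code : A → ℕ
  | A.a => 1
  | A.b => 2
  | A.c => 3

/-- The first letter is the lowest digit, so division drops a prefix and a remainder takes one;
comparing factors becomes arithmetic that the kernel can evaluate. -/
def enc : List A → ℕ
  | [] => 0
  | x :: l => code x + 4 * enc l

/-- The number of the factor of length `e` at position `i`. -/
def slice (W i e : ℕ) : ℕ := W / 4 ^ i % 4 ^ e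

/-- Whether `P` holds somewhere below `n`. -/
def anyBelow (P : ℕ → Bool) (n : ℕ) : Bool :=
  Nat.rec false (fun k ih => cond (P k) true ih) n

/-- Whether the word with number `W` and length `n` has a square as a factor. -/
def hasSquare (W n : ℕ) : Bool :=
  anyBelow (fun p => anyBelow
    (fun i => Nat.beq (slice W i (p + 1)) (slice W (i + (p + 1)) (p + 1))) (n - 2 * p - 1)) (n / 2)

/-- Whether the word with number `E` and length `e` occurs in the word with number `W` at one of
the `k` positions from `i` on. -/
def occurs (W E e i k : ℕ) : Bool := anyBelow (fun j => Nat.beq (slice W (i + j) e) E) k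

/-- `g a` and `g c` share their last five letters, so these 23 letters precede the linking word
whatever the penultimate letter of `v`. -/
def leftContext : List A := (g A.c ++ g A.b).drop 13

/-- `g b` and `g c` share their first ten letters, so these 28 letters follow the linking word
whatever the second letter of `v`. -/
def rightContext : List A := (g A.a ++ g A.b).take 28

/-- The decoding of `f s` with the letters around it. -/
def window (s : List S) : List A := leftContext ++ (link s ++ rightContext)

/-- The common beginning of all decoded linking words. -/
def leftMarker : List A := [.a, .b, .a, .c, .b, .a, .b, .c, .a, .b]

/-- The common last six letters of the decoded linking words, followed by the `aba` that starts `g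
a`. -/
def rightMarker : List A := [.a, .b, .a, .c, .b, .c, .a, .b, .a]

/-- The finitely many facts about a linking word on which the argument depends, for the number `W`
of `window s` and the length `o` of `link s`. -/
def goodWindow (W o : ℕ) : Bool :=
  Nat.ble 20 o &&
  !hasSquare W (o + 51) &&
  -- Window index 23 is the first letter of the linking word; index `o + 17` is six letters before
  -- its end.
  Nat.beq (slice W 23 10) (enc leftMarker) &&
  !occurs W (enc leftMarker) 10 0 23 && !occurs W (enc leftMarker) 10 24 (o + 18) &&
  Nat.beq (slice W (o + 17) 9) (enc rightMarker) &&
  !occurs W (enc rightMarker) 9 0 (o + 17) && !occurs W (enc rightMarker) 9 (o + 18) 25 &&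
  !occurs W (enc leftContext) 23 23 o &&
  !occurs W (enc (rightContext.drop 3)) 25 23 o &&
  Nat.beq (slice W (o + 18) 5) (enc ((g A.b).drop 13))

def good (s : List S) : Bool :=
  goodWindow (enc (window s)) (link s).length &&
  (decide (decodeEnd A.a A.b (f s) = (A.a, A.b)) &&
  (decide ((link s).count A.a ≤ (link s).count A.b + 1) &&
    decide ((link s).count A.a ≤ (link s).count A.c + 1) &&
    decide ((link s).count A.b ≤ (link s).count A.a + 1) &&
    decide ((link s).count A.b ≤ (link s).count A.c + 1) &&
    decide ((link s).count A.c ≤ (link s).count A.a + 1) &&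
    decide ((link s).count A.c ≤ (link s).count A.b + 1)))

theorem all_good : linkingWords.all good = true := by decide +kernel

theorem anyBelow_eq_false {P : ℕ → Bool} {n : ℕ} (h : anyBelow P n = false) {k : ℕ} (hk : k < n) :
    P k = false := by
  induction n with
  | zero => omega
  | succ n ih =>
    have h' : cond (P n) true (anyBelow P n) = false := h
    cases hP : P n with
    | true => simp [hP] at h'
    | false =>
      rw [hP] at h'
      rcases Nat.lt_succ_iff_lt_or_eq.mp hk with h1 | rfl
      · exact ih h' h1
      · exact hP

theorem enc_append (l m : List A) : enc (l ++ m) = enc l + 4 ^ l.length * enc m := by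
  induction l with
  | nil => simp [enc]
  | cons x l ih => simp only [List.cons_append, enc, ih, List.length_cons, pow_succ]; ring

theorem enc_lt (l : List A) : enc l < 4 ^ l.length := by
  induction l with
  | nil => simp [enc]
  | cons x l ih =>
    have : code x < 4 := by cases x <;> decide
    simp only [enc, List.length_cons, pow_succ]
    omega

theorem slice_append (l m k : List A) : slice (enc (l ++ (m ++ k))) l.length m.length = enc m := by
  rw [slice, enc_append, Nat.add_mul_div_left _ _ (by positivity), Nat.div_eq_of_lt (enc_lt l),
    zero_add, enc_append, Nat.add_mul_mod_self_left, Nat.mod_eq_of_lt (enc_lt m)]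

theorem enc_inj {l m : List A} (hl : l.length = m.length) (h : enc l = enc m) : l = m := by
  induction l generalizing m with
  | nil => exact (List.length_eq_zero_iff.mp hl.symm).symm
  | cons x l ih =>
    cases m with
    | nil => simp at hl
    | cons y m =>
      simp only [enc] at h
      have h1 : code x = code y ∧ enc l = enc m := by
        have h2 : code x < 4 := by cases x <;> decide
        have h3 : code y < 4 := by cases y <;> decide
        omega
      rw [ih (by simpa using hl) h1.2]
      have : x = y := by
        have := h1.1
        cases x <;> cases y <;> simp_all [code]
      rw [this]

/-! ### Factors of two-sided infinite words -/

/-- The factor of length `e` at position `i`. -/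
def seg {α : Type*} (t : ℤ → α) (i : ℤ) (e : ℕ) : List α := (List.range e).map fun j : ℕ => t (i + j)

section
variable {α : Type*} {t t' : ℤ → α}

@[simp] theorem length_seg (i : ℤ) (e : ℕ) : (seg t i e).length = e := by simp [seg]

theorem seg_add (t : ℤ → α) (i : ℤ) (a b : ℕ) :
    seg t i (a + b) = seg t i a ++ seg t (i + a) b := by
  simp [seg, List.range_add, add_assoc, Function.comp_def]

theorem seg_eq_iff {i i' : ℤ} {e : ℕ} :
    seg t i e = seg t' i' e ↔ ∀ j : ℕ, j < e → t (i + j) = t' (i' + j) := by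
  simp [seg]

theorem seg_congr {i i' : ℤ} {e : ℕ} (h : ∀ x : ℤ, 0 ≤ x → x < e → t (i + x) = t' (i' + x)) :
    seg t i e = seg t' i' e :=
  seg_eq_iff.mpr fun j hj => h j (by omega) (by omega)

theorem apply_of_seg_eq {i i' : ℤ} {e : ℕ} (h : seg t i e = seg t' i' e) {x : ℤ} (hx : i ≤ x)
    (hx' : x < i + e) : t x = t' (x + (i' - i)) := by
  have := seg_eq_iff.mp h (x - i).toNat (by omega)
  rw [Int.toNat_of_nonneg (by omega)] at this
  convert this using 2 <;> ring

theorem seg_sub {i i' j : ℤ} {e e' : ℕ} (h : seg t i e = seg t' i' e) (hj : i ≤ j)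
    (hj' : j + e' ≤ i + e) : seg t j e' = seg t' (j + (i' - i)) e' :=
  seg_congr fun x hx hx' => by
    rw [apply_of_seg_eq h (x := j + x) (by omega) (by omega)]
    congr 1; ring

theorem seg_drop (i : ℤ) (a b : ℕ) : (seg t i (a + b)).drop a = seg t (i + a) b := by
  rw [seg_add, List.drop_left' (length_seg _ _)]

theorem seg_take (i : ℤ) (a b : ℕ) : (seg t i (a + b)).take a = seg t i a := by
  rw [seg_add, List.take_left' (length_seg _ _)]

theorem seg_getD (i : ℤ) (e : ℕ) {j : ℕ} (hj : j < e) (d : α) :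
    (seg t i e).getD j d = t (i + j) := by
  simp [seg, List.getD_eq_getElem?_getD, hj]

end

theorem slice_seg (t : ℤ → A) (b : ℤ) {i e n : ℕ} (h : i + e ≤ n) :
    slice (enc (seg t b n)) i e = enc (seg t (b + i) e) := by
  obtain ⟨k, rfl⟩ := Nat.exists_eq_add_of_le h
  rw [add_assoc, seg_add, seg_add]
  simpa using slice_append (seg t b i) (seg t (b + i) e) (seg t (b + i + e) k)

theorem seg_ne_of_hasSquare {t : ℤ → A} {b : ℤ} {n : ℕ} (h : hasSquare (enc (seg t b n)) n = false)
    {i : ℤ} {p : ℕ} (hp : 1 ≤ p) (hi : b ≤ i) (hi' : i + 2 * p ≤ b + n) :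
    seg t i p ≠ seg t (i + p) p := by
  intro he
  have h1 := anyBelow_eq_false h (k := p - 1) (by omega)
  have h2 := anyBelow_eq_false h1 (k := (i - b).toNat) (by omega)
  rw [Nat.sub_add_cancel hp, slice_seg _ _ (by omega), slice_seg _ _ (by omega)] at h2
  push_cast at h2
  rw [Int.toNat_of_nonneg (by omega), show b + (i - b) = i by ring,
    show b + (i - b + p) = i + p by ring, he] at h2
  simp at h2

theorem seg_ne_of_occurs {t : ℤ → A} {b : ℤ} {n e a k : ℕ} {E : List A}
    (h : occurs (enc (seg t b n)) (enc E) e a k = false) {i : ℤ} (hi : b + a ≤ i)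
    (hi' : i < b + a + k) (hn : i + e ≤ b + n) : seg t i e ≠ E := by
  intro he
  have h2 := anyBelow_eq_false h (k := (i - b - a).toNat) (by omega)
  rw [slice_seg _ _ (by omega)] at h2
  push_cast at h2
  rw [Int.toNat_of_nonneg (by omega), show b + (a + (i - b - a)) = i by ring, he] at h2
  simp at h2

theorem seg_eq_of_slice {t : ℤ → A} {b : ℤ} {n e a : ℕ} {E : List A}
    (h : Nat.beq (slice (enc (seg t b n)) a e) (enc E) = true) (hn : a + e ≤ n)
    (hE : E.length = e) : seg t (b + a) e = E := by
  rw [slice_seg _ _ hn] at h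
  exact enc_inj (by simp [hE]) (Nat.eq_of_beq_eq_true h)

/-! ### Words over the images of `g` -/

/-- The two-sided infinite word `⋯ g (V 0) g (V 1) ⋯`. -/
def blockWord (V : ℤ → A) (x : ℤ) : A := (g (V (x / 18))).getD (x % 18).toNat A.a

theorem length_g (x : A) : (g x).length = 18 := by cases x <;> rfl

theorem seg_blockWord (V : ℤ → A) (m : ℤ) : seg (blockWord V) (18 * m) 18 = g (V m) := by
  refine List.ext_getElem (by simp [length_g]) fun j hj hj' => ?_
  simp only [length_seg] at hj
  have h1 : (18 * m + j) / 18 = m := by omega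
  have h2 : ((18 * m + j) % 18).toNat = j := by omega
  simp only [seg, List.getElem_map, List.getElem_range, blockWord, h1, h2]
  exact List.getD_eq_getElem _ _ hj'

theorem seg_blockWord_two (V : ℤ → A) (m : ℤ) :
    seg (blockWord V) (18 * m) 36 = g (V m) ++ g (V (m + 1)) := by
  rw [show 36 = 18 + 18 from rfl, seg_add, seg_blockWord, ← seg_blockWord V (m + 1)]
  congr 2
  push_cast; ring

theorem seg_blockWord_three (V : ℤ → A) (m : ℤ) :
    seg (blockWord V) (18 * m) 54 = g (V m) ++ (g (V (m + 1)) ++ g (V (m + 2))) := by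
  rw [show 54 = 18 + 36 from rfl, seg_add, seg_blockWord,
    show 18 * m + ((18 : ℕ) : ℤ) = 18 * (m + 1) by push_cast; ring, seg_blockWord_two, add_assoc]
  rfl

theorem not_occurs_leftMarker {x y : A} (h : x ≠ y) :
    occurs (enc (g x ++ g y)) (enc leftMarker) 10 0 18 = false := by
  revert h; cases x <;> cases y <;> decide +kernel

theorem not_occurs_rightMarker {x y : A} (h : x ≠ y) :
    occurs (enc (g x ++ g y)) (enc rightMarker) 9 0 18 = false := by
  revert h; cases x <;> cases y <;> decide +kernel

/-- Position 0 is left out because every block starts with `aba`: this factor marks the block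
boundaries. -/
theorem not_occurs_aba {x y : A} (h : x ≠ y) :
    occurs (enc (g x ++ g y)) (enc [.a, .b, .a]) 3 1 17 = false := by
  revert h; cases x <;> cases y <;> decide +kernel

theorem not_hasSquare_three {x y z : A} (h : x ≠ y) (h' : y ≠ z) :
    hasSquare (enc (g x ++ (g y ++ g z))) 54 = false := by
  revert h h'; cases x <;> cases y <;> cases z <;> decide +kernel

theorem not_hasSquare_end {x : A} (h : x ≠ A.b) :
    hasSquare (enc ((g x ++ g A.b) ++ leftMarker.take 9)) 45 = false := by
  revert h; cases x <;> decide +kernel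

/-! ### The circular words to be shown square-free -/

/-- `t` is a periodic word with period `link s g (V 0) ⋯ g (V (n - 1))`, where `V 0 ⋯ V (n - 1)` is
square-free with first letter `a` and last letter `b`, and is extended by `b` on the left and by
`a` on the right. -/
structure IsLinked (t : ℤ → A) (s : List S) (V : ℤ → A) (o n : ℤ) : Prop where
  goodWindow : goodWindow (enc (window s)) (link s).length = true
  two_le : 2 ≤ n
  length : o = (link s).length
  periodic : Function.Periodic t (o + 18 * n)
  link : seg t 0 (link s).length = link s
  block : ∀ m, 0 ≤ m → m < n → seg t (o + 18 * m) 18 = g (V m)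
  first : V 0 = A.a
  last : V (n - 1) = A.b
  before : V (-1) = A.b
  after : V n = A.a
  ne : ∀ m, -1 ≤ m → m < n → V m ≠ V (m + 1)
  squareFree : ∀ i q, 0 ≤ i → 1 ≤ q → i + 2 * q ≤ n → ∃ k, 0 ≤ k ∧ k < q ∧ V (i + k) ≠ V (i + q + k)

namespace IsLinked

variable {t : ℤ → A} {s : List S} {V : ℤ → A} {o n : ℤ}

/-! ### The surroundings of the linking word -/

theorem seg_periodic (H : IsLinked t s V o n) (k x : ℤ) (e : ℕ) :
    seg t (x + k * (o + 18 * n)) e = seg t x e :=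
  seg_congr fun y _ _ => by
    rw [add_right_comm]
    exact H.periodic.int_mul k _

theorem block_inner (H : IsLinked t s V o n) {x : ℤ} (hx : 0 ≤ x) (hx' : x < 18 * n) :
    t (o + x) = blockWord V x := by
  have h := (H.block (x / 18) (by omega) (by omega)).trans (seg_blockWord V (x / 18)).symm
  rw [apply_of_seg_eq h (by omega) (by omega)]
  congr 1; ring

theorem seg_left (H : IsLinked t s V o n) : seg t (-23) 23 = leftContext := by
  have h1 : seg t (-18) 18 = g A.b := by
    rw [← H.last, ← H.block (n - 1) (by linarith [H.two_le]) (by linarith),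
      ← H.seg_periodic 1 (-18)]
    congr 1; ring
  have h2 : seg t (-23) 5 = (g (V (n - 2))).drop 13 := by
    rw [← H.block (n - 2) (by linarith [H.two_le]) (by linarith), show 18 = 13 + 5 from rfl,
      seg_drop, ← H.seg_periodic 1 (-23)]
    congr 1; push_cast; ring
  have h3 : V (n - 2) ≠ A.b := by
    have := H.ne (n - 2) (by linarith [H.two_le]) (by linarith)
    rwa [show n - 2 + 1 = n - 1 by ring, H.last] at this
  have h4 : leftContext = (g (V (n - 2))).drop 13 ++ g A.b := by
    cases h : V (n - 2) <;> first | rfl | exact absurd h h3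
  rw [h4, ← h2, ← h1, show 23 = 5 + 18 from rfl, seg_add]
  rfl

theorem seg_right (H : IsLinked t s V o n) : seg t o 28 = rightContext := by
  have h1 : seg t o 18 = g A.a := by
    rw [← H.first, ← H.block 0 le_rfl (by linarith [H.two_le])]; simp
  have h2 : seg t (o + 18) 10 = (g (V 1)).take 10 := by
    rw [← H.block 1 (by norm_num) (by linarith [H.two_le]), show 18 = 10 + 8 from rfl, seg_take]
    rfl
  have h3 : V 1 ≠ A.a := by
    have := H.ne 0 (by norm_num) (by linarith [H.two_le])
    rw [H.first] at this
    exact this.symm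
  have h4 : rightContext = g A.a ++ (g (V 1)).take 10 := by
    cases h : V 1 <;> first | rfl | exact absurd h h3
  rw [h4, ← h2, ← h1, show 28 = 18 + 10 from rfl, seg_add]
  rfl

theorem window_eq (H : IsLinked t s V o n) :
    seg t (-23) ((LevelWords.link s).length + 51) = window s := by
  rw [window, ← H.seg_left, ← H.seg_right, show (LevelWords.link s).length + 51 =
    23 + ((LevelWords.link s).length + 28) by ring, seg_add, show (-23 : ℤ) + (23 : ℕ) = 0 by simp,
    seg_add, H.link, zero_add, ← H.length]

/-- The content of `goodWindow`, with indices shifted by 23 because the window starts at position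
-23. -/
theorem checks (H : IsLinked t s V o n) :
    20 ≤ o ∧
    (∀ (i : ℤ) (p : ℕ), 1 ≤ p → -23 ≤ i → i + 2 * p ≤ o + 28 → seg t i p ≠ seg t (i + p) p) ∧
    seg t 0 10 = leftMarker ∧
    (∀ i : ℤ, -23 ≤ i → i + 10 ≤ o + 28 → i ≠ 0 → seg t i 10 ≠ leftMarker) ∧
    seg t (o - 6) 9 = rightMarker ∧
    (∀ i : ℤ, -23 ≤ i → i + 9 ≤ o + 28 → i ≠ o - 6 → seg t i 9 ≠ rightMarker) ∧
    (∀ i : ℤ, 0 ≤ i → i + 23 ≤ o + 2 → seg t i 23 ≠ seg t (-23) 23) ∧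
    (∀ i : ℤ, 0 ≤ i → i + 25 ≤ o + 2 → seg t i 25 ≠ seg t (o + 3) 25) ∧
    seg t (o - 5) 5 = (g A.b).drop 13 := by
  have hW := H.window_eq
  have hg := H.goodWindow
  have ho := H.length
  have hL := H.seg_left
  have hR : seg t (o + 3) 25 = rightContext.drop 3 := by
    rw [← H.seg_right, show 28 = 3 + 25 from rfl, seg_drop]; rfl
  rw [← hW] at hg
  simp only [LevelWords.goodWindow, Bool.and_eq_true, Bool.not_eq_true'] at hg
  obtain ⟨⟨⟨⟨⟨⟨⟨⟨⟨⟨c1, c2⟩, c3⟩, c4⟩, c5⟩, c6⟩, c7⟩, c8⟩, c9⟩, c10⟩, c11⟩ := hg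
  have c1 := Nat.le_of_ble_eq_true c1
  refine ⟨by omega, fun i p hp hi hi' => seg_ne_of_hasSquare c2 hp hi (by push_cast; omega), ?_,
    fun i hi hi' h0 => ?_, ?_, fun i hi hi' h0 => ?_, fun i hi hi' => ?_, fun i hi hi' => ?_, ?_⟩
  · simpa using seg_eq_of_slice c3 (by omega) rfl
  · rcases lt_or_gt_of_ne h0 with h | h
    · exact seg_ne_of_occurs c4 (by simpa using hi) (by push_cast; omega) (by push_cast; omega)
    · exact seg_ne_of_occurs c5 (by push_cast; omega) (by push_cast; omega) (by push_cast; omega)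
  · rw [← seg_eq_of_slice c6 (by omega) rfl]
    congr 1; push_cast; omega
  · rcases lt_or_gt_of_ne h0 with h | h
    · exact seg_ne_of_occurs c7 (by simpa using hi) (by push_cast; omega) (by push_cast; omega)
    · exact seg_ne_of_occurs c8 (by push_cast; omega) (by push_cast; omega) (by push_cast; omega)
  · rw [hL]
    exact seg_ne_of_occurs c9 (by push_cast; omega) (by push_cast; omega) (by push_cast; omega)
  · rw [hR]
    exact seg_ne_of_occurs c10 (by push_cast; omega) (by push_cast; omega) (by push_cast; omega)
  · rw [← seg_eq_of_slice c11 (by omega) rfl]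
    congr 1; push_cast; omega

theorem seg_block_inner (H : IsLinked t s V o n) {x : ℤ} {e : ℕ} (hx : 0 ≤ x)
    (hx' : x + e ≤ 18 * n) : seg t (o + x) e = seg (blockWord V) x e :=
  seg_congr fun y _ _ => by
    rw [add_assoc]
    exact H.block_inner (by omega) (by omega)

/-! ### Markers, and squares meeting the linking word -/

/-- A factor shorter than the contexts which occurs nowhere in a word `g x y` with `x ≠ y` occurs
only at positions meeting the linking word. -/
theorem dvd_of_seg_eq (H : IsLinked t s V o n) {E : List A} {e : ℕ} {a x : ℤ} (he : 0 < e)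
    (he' : e ≤ 19) (hE : ∀ x y : A, x ≠ y → occurs (enc (g x ++ g y)) (enc E) e 0 18 = false)
    (hW : ∀ i : ℤ, -23 ≤ i → i + e ≤ o + 28 → i ≠ a → seg t i e ≠ E) (hx : seg t x e = E) :
    o + 18 * n ∣ x - a := by
  have hn := H.two_le
  have ho := H.length
  have hN : 0 < o + 18 * n := by omega
  -- With this representative, an occurrence starting before `o` lies in the window, and any other
  -- ends before the next linking word.
  obtain ⟨k, y, hy, hy', rfl⟩ : ∃ k y : ℤ, -e < y ∧ y ≤ o + 18 * n - e ∧
      x = y + k * (o + 18 * n) := by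
    refine ⟨(x + (e - 1)) / (o + 18 * n), (x + (e - 1)) % (o + 18 * n) - (e - 1), ?_, ?_, ?_⟩
    · have := Int.emod_nonneg (x + (e - 1)) hN.ne'
      omega
    · have := Int.emod_lt_of_pos (x + (e - 1)) hN
      omega
    · have := Int.emod_add_mul_ediv (x + (e - 1)) (o + 18 * n)
      linarith
  rw [H.seg_periodic] at hx
  rcases lt_or_ge y o with h | h
  · by_cases hya : y = a
    · exact ⟨k, by rw [hya]; ring⟩
    · exact absurd hx (hW y (by omega) (by omega) hya)
  · exfalso
    obtain ⟨z, rfl⟩ : ∃ z, y = o + z := ⟨y - o, by ring⟩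
    rw [H.seg_block_inner (by omega) (by omega)] at hx
    -- In the last block the second letter is the artificial `V n = a`; the factor itself does not
    -- leave that block.
    have h1 := hE _ _ (H.ne (z / 18) (by omega) (by omega))
    rw [← seg_blockWord_two] at h1
    exact seg_ne_of_occurs h1 (by push_cast; omega) (by push_cast; omega) (by push_cast; omega) hx

theorem dvd_of_leftMarker (H : IsLinked t s V o n) {x : ℤ} (hx : seg t x 10 = leftMarker) :
    o + 18 * n ∣ x := by
  simpa using H.dvd_of_seg_eq (by norm_num) (by norm_num)
    (fun _ _ => not_occurs_leftMarker) H.checks.2.2.2.1 hx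

theorem dvd_of_rightMarker (H : IsLinked t s V o n) {x : ℤ} (hx : seg t x 9 = rightMarker) :
    o + 18 * n ∣ x - (o - 6) :=
  H.dvd_of_seg_eq (by norm_num) (by norm_num)
    (fun _ _ => not_occurs_rightMarker) H.checks.2.2.2.2.2.1 hx

theorem not_dvd_period {p : ℕ} (hp : 1 ≤ p) (hN : 2 * p ≤ o + 18 * n) :
    ¬ o + 18 * n ∣ (p : ℤ) := fun h => by
  have := Int.le_of_dvd (by omega) h
  omega

/-- An occurrence of a factor inside a square contains the centre of the square, if the factor
recurs only at multiples of the period of `t`. -/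
theorem centre_mem {i a : ℤ} {p e : ℕ} {E : List A} (hp : 1 ≤ p)
    (hN : 2 * p ≤ o + 18 * n) (hE : seg t a e = E)
    (hu : ∀ x, seg t x e = E → o + 18 * n ∣ x - a) (h : seg t i p = seg t (i + p) p)
    (hi : i ≤ a) (hi' : a + e ≤ i + 2 * p) : a < i + p ∧ i + p < a + e := by
  have hd := not_dvd_period hp hN
  constructor
  · by_contra hc
    have h1 := seg_sub h.symm (j := a) (e' := e) (by omega) (by omega)
    have h2 := hu _ (h1.symm.trans hE)
    rw [show a + (i - (i + p)) - a = -(p : ℤ) by ring, dvd_neg] at h2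
    exact hd h2
  · by_contra hc
    have h1 := seg_sub h (j := a) (e' := e) (by omega) (by omega)
    have h2 := hu _ (h1.symm.trans hE)
    rw [show a + (i + p - i) - a = (p : ℤ) by ring] at h2
    exact hd h2

theorem seg_ne_of_meets (H : IsLinked t s V o n) {i : ℤ} {p : ℕ} (hp : 1 ≤ p)
    (hN : 2 * p ≤ o + 18 * n) (h1 : i < o - 5) (h2 : 9 < i + 2 * p) :
    seg t i p ≠ seg t (i + p) p := by
  intro h
  obtain ⟨ho, hsq, hL, -, hR, -, hDL, hDR, -⟩ := H.checks
  have hcL := centre_mem hp hN hL (fun x hx => by simpa using H.dvd_of_leftMarker hx) h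
  have hcR := centre_mem hp hN hR (fun x hx => H.dvd_of_rightMarker hx) h
  push_cast at hcL hcR
  rcases lt_or_ge i (-23) with hi | hi
  · have hc := hcL (by omega) (by omega)
    by_cases hj : o + 3 ≤ i + 2 * p
    · have := hcR (by omega) (by omega)
      omega
    -- The centre is right of 0, so the first half contains the whole left context, and its copy
    -- starts inside the linking word.
    · have h3 := seg_sub h (j := -23) (e' := 23) (by omega) (by push_cast; omega)
      exact hDL _ (by omega) (by omega) h3.symm
  · rcases le_or_gt (i + 2 * p) (o + 28) with hj | hj
    · exact hsq i p hp hi hj h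
    · have hc := hcR (by omega) (by omega)
      by_cases hi0 : i ≤ 0
      · have := hcL (by omega) (by omega)
        omega
      -- The centre is left of `o + 3`, so the second half contains the rest of the right context,
      -- copied to a start inside the linking word.
      · have h3 := seg_sub h.symm (j := o + 3) (e' := 25) (by omega) (by push_cast; omega)
        exact hDR _ (by omega) (by omega) h3.symm

/-! ### Squares among the blocks -/

/-- The linking word ends with the last five letters of `g b` and starts with the first four of `g
a`, so the block structure extends slightly into it on both sides. -/
theorem apply_eq_blockWord (H : IsLinked t s V o n) {x : ℤ} (hx : -5 ≤ x) (hx' : x < 18 * n + 4) :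
    t (o + x) = blockWord V x := by
  obtain ⟨-, -, hL, -, -, -, -, -, hR⟩ := H.checks
  rcases lt_or_ge x 0 with h | h
  · have h1 : seg (blockWord V) (-5) 5 = (g A.b).drop 13 := by
      rw [← H.before, ← seg_blockWord, show 18 = 13 + 5 from rfl, seg_drop]
      rfl
    rw [apply_of_seg_eq (hR.trans h1.symm) (by omega) (by omega)]
    congr 1; ring
  · rcases lt_or_ge x (18 * n) with h' | h'
    · exact H.block_inner h h'
    · have h1 : seg (blockWord V) (18 * n) 4 = (g A.a).take 4 := by
        rw [← H.after, ← seg_blockWord, show 18 = 4 + 14 from rfl, seg_take]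
      have h2 : seg t 0 4 = (g A.a).take 4 := by
        rw [← seg_take 0 4 6, hL]
        rfl
      rw [show o + x = (x - 18 * n) + (o + 18 * n) by ring, H.periodic,
        apply_of_seg_eq (h2.trans h1.symm) (by omega) (by omega)]
      congr 1; ring

theorem seg_eq_blockWord (H : IsLinked t s V o n) {x : ℤ} {e : ℕ} (hx : -5 ≤ x)
    (hx' : x + e ≤ 18 * n + 4) : seg t (o + x) e = seg (blockWord V) x e :=
  seg_congr fun y _ _ => by
    rw [add_assoc]
    exact H.apply_eq_blockWord (by omega) (by omega)

theorem seg_end (H : IsLinked t s V o n) : seg t (o + 18 * n) 9 = leftMarker.take 9 := by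
  rw [← H.checks.2.2.1, show 10 = 9 + 1 from rfl, seg_take, ← H.seg_periodic 1 0]
  congr 1; ring

/-- At most 36 letters fit into three consecutive blocks, or into the last two blocks and nine
letters of the left marker. -/
theorem seg_ne_of_le (H : IsLinked t s V o n) {x : ℤ} {p : ℕ} (hp : 1 ≤ p) (hp' : p ≤ 18)
    (hx : -5 ≤ x) (hx' : x + 2 * p ≤ 18 * n + 9) : seg t (o + x) p ≠ seg t (o + x + p) p := by
  have hn := H.two_le
  rcases le_or_gt (x + 2 * p) (18 * n + 4) with h | h
  · obtain ⟨m, hm, hm', h1, h2⟩ : ∃ m, -1 ≤ m ∧ m + 2 ≤ n ∧ 18 * m ≤ x ∧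
        x + 2 * p ≤ 18 * m + 54 := by
      rcases le_or_gt (x / 18) (n - 2) with h | h
      · exact ⟨x / 18, by omega, by omega, by omega, by omega⟩
      · exact ⟨n - 2, by omega, by omega, by omega, by omega⟩
    rw [H.seg_eq_blockWord hx (by omega), add_assoc, H.seg_eq_blockWord (by omega) (by omega)]
    have h3 := not_hasSquare_three (H.ne m hm (by omega)) (H.ne (m + 1) (by omega) (by omega))
    rw [add_assoc, show (1 : ℤ) + 1 = 2 from rfl, ← seg_blockWord_three] at h3
    exact seg_ne_of_hasSquare h3 hp h1 h2
  · have h1 : V (n - 2) ≠ A.b := by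
      have := H.ne (n - 2) (by omega) (by omega)
      rwa [show n - 2 + 1 = n - 1 by ring, H.last] at this
    have h2 : seg t (o + 18 * (n - 2)) 45 =
        (g (V (n - 2)) ++ g A.b) ++ leftMarker.take 9 := by
      rw [← H.last, ← H.block (n - 2) (by omega) (by omega),
        ← H.block (n - 1) (by omega) (by omega), ← H.seg_end, show 45 = 18 + 18 + 9 from rfl,
        seg_add, seg_add, show o + 18 * (n - 2) + (18 : ℕ) = o + 18 * (n - 1) by push_cast; ring,
        show o + 18 * (n - 2) + (18 + 18 : ℕ) = o + 18 * n by push_cast; ring]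
    have h3 := not_hasSquare_end h1
    rw [← h2] at h3
    exact seg_ne_of_hasSquare h3 hp (by omega) (by push_cast; omega)

theorem seg_eq_aba_iff (H : IsLinked t s V o n) {x : ℤ} (hx : -5 ≤ x) (hx' : x + 3 ≤ 18 * n + 9) :
    seg t (o + x) 3 = [A.a, A.b, A.a] ↔ 18 ∣ x := by
  have hn := H.two_le
  rcases lt_or_ge x (18 * n) with h | h
  · rw [H.seg_eq_blockWord hx (by push_cast; omega)]
    constructor
    · intro he
      by_contra hd
      have h1 := not_occurs_aba (H.ne (x / 18) (by omega) (by omega))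
      rw [← seg_blockWord_two] at h1
      exact seg_ne_of_occurs h1 (by push_cast; omega) (by push_cast; omega) (by push_cast; omega) he
    · rintro ⟨m, rfl⟩
      rw [← seg_take _ 3 15, seg_blockWord]
      cases V m <;> rfl
  · obtain ⟨j, hj, rfl⟩ : ∃ j : ℕ, j < 7 ∧ x = 18 * n + j :=
      ⟨(x - 18 * n).toNat, by omega, by omega⟩
    obtain ⟨k, hk⟩ : ∃ k, 9 = j + (3 + k) := ⟨6 - j, by omega⟩
    have h1 : seg t (o + (18 * n + j)) 3 = ((leftMarker.take 9).drop j).take 3 := by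
      rw [← H.seg_end, hk, seg_drop, seg_take, add_assoc]
    rw [h1]
    have h2 : (18 : ℤ) ∣ 18 * n + j ↔ j = 0 := by omega
    rw [h2]
    interval_cases j <;> decide

/-- At index 12 the blocks `g a`, `g b`, `g c` have the distinct letters `a`, `c`, `b`. -/
theorem blockWord_twelve_inj {m m' : ℤ}
    (h : blockWord V (18 * m + 12) = blockWord V (18 * m' + 12)) : V m = V m' := by
  have h1 (m : ℤ) : blockWord V (18 * m + 12) = (g (V m)).getD 12 A.a := by
    rw [blockWord, show (18 * m + 12) / 18 = m by omega, show (18 * m + 12) % 18 = 12 by omega]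
    rfl
  rw [h1, h1] at h
  generalize V m = x at h
  generalize V m' = y at h
  revert h
  cases x <;> cases y <;> simp [g]

theorem seg_ne_of_outer (H : IsLinked t s V o n) {x : ℤ} {p : ℕ} (hp : 1 ≤ p)
    (hx : -5 ≤ x) (hx' : x + 2 * p ≤ 18 * n + 9) : seg t (o + x) p ≠ seg t (o + x + p) p := by
  have hn := H.two_le
  intro h
  rcases le_or_gt p 18 with h18 | h18
  · exact H.seg_ne_of_le hp h18 hx hx' h
  have hshift (y : ℤ) (hy : x ≤ y) (hy' : y < x + p) : t (o + y) = t (o + (y + p)) := by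
    rw [apply_of_seg_eq h (by omega) (by omega)]
    congr 1; ring
  -- As `p > 18`, one of the halves contains the `aba` at some block start; its copy in the other
  -- half must also be at a multiple of 18.
  obtain ⟨q, hq⟩ : 18 ∣ (p : ℤ) := by
    obtain ⟨k, hk, hk'⟩ : ∃ k, x ≤ 18 * k ∧ 18 * k < x + 18 := ⟨(x + 17) / 18, by omega, by omega⟩
    by_cases hc : 18 * k + 3 ≤ x + p
    · have h1 := seg_sub h (j := o + 18 * k) (e' := 3) (by omega) (by push_cast; omega)
      rw [(H.seg_eq_aba_iff (by omega) (by omega)).mpr ⟨k, rfl⟩,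
        show o + 18 * k + (o + x + p - (o + x)) = o + (18 * k + p) by ring] at h1
      have := (H.seg_eq_aba_iff (by omega) (by omega)).mp h1.symm
      omega
    · have h1 := seg_sub h.symm (j := o + (18 * (k + 1))) (e' := 3) (by omega) (by push_cast; omega)
      rw [(H.seg_eq_aba_iff (by omega) (by omega)).mpr ⟨k + 1, rfl⟩,
        show o + 18 * (k + 1) + (o + x - (o + x + p)) = o + (18 * (k + 1) - p) by ring] at h1
      have := (H.seg_eq_aba_iff (by omega) (by omega)).mp h1.symm
      omega
  -- At index 4 every block has `a` but the left marker has `b`, so the square must stop before that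
  -- letter.
  have hend : x + 2 * p ≤ 18 * n + 4 := by
    by_contra hc
    have h1 := hshift (18 * n + 4 - p) (by omega) (by omega)
    have h2 : t (o + (18 * n + 4)) = A.b := by
      have h3 := seg_getD (t := t) (o + 18 * n) 9 (j := 4) (by norm_num) A.a
      rw [H.seg_end] at h3
      rw [← add_assoc]
      exact h3.symm
    have h4 : blockWord V (18 * n + 4 - p) = A.a := by
      rw [blockWord, show (18 * n + 4 - p) % 18 = 4 by omega]
      cases V ((18 * n + 4 - p) / 18) <;> rfl
    rw [sub_add_cancel, h2, H.apply_eq_blockWord (by omega) (by omega), h4] at h1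
    cases h1
  -- The first index-12 letter in the square. As `x ≥ -5`, it is not in block -1, so the square
  -- found in `V` stays within `v`.
  obtain ⟨m, hm, hm'⟩ : ∃ m, x ≤ 18 * m + 12 ∧ 18 * m + 12 < x + 18 :=
    ⟨(x + 5) / 18, by omega, by omega⟩
  obtain ⟨k, hk, hk', hne⟩ := H.squareFree m q (by omega) (by omega) (by omega)
  refine hne (blockWord_twelve_inj ?_)
  have h1 := hshift (18 * (m + k) + 12) (by omega) (by omega)
  rw [H.apply_eq_blockWord (by omega) (by omega), H.apply_eq_blockWord (by omega) (by omega)] at h1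
  rw [h1]
  congr 1
  rw [hq]; ring

theorem seg_ne (H : IsLinked t s V o n) (i : ℤ) {p : ℕ} (hp : 1 ≤ p) (hN : 2 * p ≤ o + 18 * n) :
    seg t i p ≠ seg t (i + p) p := by
  have ho := H.checks.1
  have hn := H.two_le
  obtain ⟨k, x, hx, hx', rfl⟩ : ∃ k x : ℤ, -5 ≤ x ∧ x < o + 18 * n - 5 ∧
      i = o + x + k * (o + 18 * n) := by
    refine ⟨(i - (o - 5)) / (o + 18 * n), (i - (o - 5)) % (o + 18 * n) - 5, ?_, ?_, ?_⟩
    · have := Int.emod_nonneg (i - (o - 5)) (b := o + 18 * n) (by omega)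
      omega
    · have := Int.emod_lt_of_pos (i - (o - 5)) (b := o + 18 * n) (by omega)
      omega
    · have := Int.emod_add_mul_ediv (i - (o - 5)) (o + 18 * n)
      linarith
  rw [H.seg_periodic, add_right_comm (o + x), H.seg_periodic]
  -- A square ending later contains the next left marker; moved back by one period, it meets the
  -- linking word at 0.
  rcases le_or_gt (x + 2 * p) (18 * n + 9) with h | h
  · exact H.seg_ne_of_outer hp hx h
  · have h1 := H.seg_ne_of_meets (i := o + x + (-1) * (o + 18 * n)) hp hN (by omega) (by omega)
    rwa [H.seg_periodic, add_right_comm (o + x), H.seg_periodic] at h1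

end IsLinked
/-! ### Circular words as periodic words -/

/-- The periodic word `⋯ l l l ⋯`. -/
def cyc (l : List A) (x : ℤ) : A := l.getD (x % l.length).toNat A.a

theorem cyc_periodic (l : List A) : Function.Periodic (cyc l) l.length := fun x => by
  simp [cyc]

theorem seg_cyc_rotate (l : List A) (k : ℕ) : seg (cyc l) k l.length = l.rotate k := by
  refine List.ext_getElem (by simp) fun i hi hi' => ?_
  simp only [length_seg] at hi
  have h1 : (((k : ℤ) + i) % l.length).toNat = (i + k) % l.length := by
    rw [add_comm]; norm_cast
  simp only [seg, List.getElem_map, List.getElem_range, List.getElem_rotate, cyc, h1]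
  exact List.getD_eq_getElem _ _ _

theorem seg_cyc_append (l m k : List A) :
    seg (cyc (l ++ (m ++ k))) l.length m.length = m := by
  have h := seg_cyc_rotate (l ++ (m ++ k)) 0
  rw [List.rotate_zero, List.length_append, List.length_append, seg_add, seg_add] at h
  have h1 := (List.append_inj h (by simp)).2
  simpa using (List.append_inj h1 (by simp)).1

theorem circularSquareFree_of_seg_ne {l : List A}
    (h : ∀ (i : ℤ) (p : ℕ), 1 ≤ p → 2 * p ≤ (l.length : ℤ) →
      seg (cyc l) i p ≠ seg (cyc l) (i + p) p) : CircularSquareFree (l : Cycle A) := by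
  rintro x hx ⟨w, hw, u, v, huv⟩
  obtain ⟨k, rfl⟩ := (Cycle.coe_eq_coe.mp hw).symm
  rw [← seg_cyc_rotate] at huv
  have hl := congrArg List.length huv
  simp only [List.length_append, length_seg] at hl
  rw [← hl, List.append_assoc, List.append_assoc, show u.length + (x.length + x.length) + v.length =
    u.length + (x.length + (x.length + v.length)) by ring, seg_add, seg_add, seg_add] at huv
  have h1 := (List.append_inj huv (by simp)).2
  have h2 := List.append_inj h1 (by simp)
  have h3 := (List.append_inj h2.2 (by simp)).1
  exact h _ x.length (List.length_pos_iff.mpr hx) (by omega) (h2.1.symm.trans h3)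

theorem CircularSquareFree.map {l : List A} (h : CircularSquareFree (l : Cycle A))
    (π : Equiv.Perm A) : CircularSquareFree (l.map π : Cycle A) := by
  rintro x hx ⟨w, hw, hf⟩
  refine h (x.map π.symm) (by simpa using hx) ⟨w.map π.symm, ?_, ?_⟩
  · rw [Cycle.coe_eq_coe] at hw ⊢
    simpa using hw.map π.symm
  · rw [← List.map_append]
    exact hf.map π.symm

theorem IsLevel.map {l : List A} (h : IsLevel (l : Cycle A)) (π : Equiv.Perm A) :
    IsLevel (l.map π : Cycle A) := by
  intro x y
  have h1 := h (π.symm x) (π.symm y)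
  simp only [Cycle.coe_toMultiset, Multiset.coe_count] at h1 ⊢
  rw [← π.apply_symm_apply x, ← π.apply_symm_apply y, List.count_map_of_injective _ _ π.injective,
    List.count_map_of_injective _ _ π.injective]
  exact h1

theorem apply_ne_of_circularSquareFree {l : List A} (h : CircularSquareFree (l : Cycle A))
    {i q : ℕ} (hq : 1 ≤ q) (hi : i + 2 * q ≤ l.length) :
    ∃ k < q, l.getD (i + k) A.a ≠ l.getD (i + q + k) A.a := by
  by_contra! hc
  have h1 : (l.drop i).take q = (l.drop (i + q)).take q := by
    refine List.ext_getElem (by simp; omega) fun k hk hk' => ?_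
    have hkq : k < q := by simp at hk; omega
    have := hc k hkq
    rw [List.getD_eq_getElem _ _ (by omega), List.getD_eq_getElem _ _ (by omega)] at this
    simpa using this
  refine h ((l.drop i).take q) ?_ ⟨l, rfl, l.take i, l.drop (i + 2 * q), ?_⟩
  · rw [← List.length_pos_iff, List.length_take, List.length_drop]
    omega
  · have h2 := List.take_append_drop q (l.drop (i + q))
    have h3 := List.take_append_drop q (l.drop i)
    rw [List.drop_drop, show i + q + q = i + 2 * q by ring, ← h1] at h2
    rw [List.drop_drop, ← h2, ← List.append_assoc] at h3
    rw [List.append_assoc, h3, List.take_append_drop]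

/-! ### The word coded by `f (h v ++ s)` -/

theorem decode_append (x y : A) (u v : List B) : decode x y (u ++ v) =
    decode x y u ++ decode (decodeEnd x y u).1 (decodeEnd x y u).2 v := by
  induction u generalizing x y with
  | nil => rfl
  | cons b u ih => simp [decode, decodeEnd, ih]

theorem decodeEnd_append (x y : A) (u v : List B) : decodeEnd x y (u ++ v) =
    decodeEnd (decodeEnd x y u).1 (decodeEnd x y u).2 v := by
  induction u generalizing x y with
  | nil => rfl
  | cons b u ih => simp [decodeEnd, ih]

theorem f_append (u v : List S) : f (u ++ v) = f u ++ f v := by simp [f]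

theorem decode_f_h (v : List A) : decode A.a A.b (f (h v)) = v.flatMap g ∧
    decodeEnd A.a A.b (f (h v)) = (A.a, A.b) := by
  induction v with
  | nil => exact ⟨rfl, rfl⟩
  | cons x v ih =>
    have h1 : decode A.a A.b (f (hLetter x)) = g x ∧
      decodeEnd A.a A.b (f (hLetter x)) = (A.a, A.b) := by cases x <;> decide
    have h2 : f (h (x :: v)) = f (hLetter x) ++ f (h v) := by simp [h, f]
    rw [h2, decode_append, decodeEnd_append, h1.1, h1.2, ih.1, ih.2]
    simp

theorem length_decode (x y : A) (u : List B) : (decode x y u).length = u.length := by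
  induction u generalizing x y with
  | nil => rfl
  | cons b u ih => simp [decode, ih]

theorem length_flatMap_g (v : List A) : (v.flatMap g).length = 18 * v.length := by
  induction v with
  | nil => rfl
  | cons x v ih => simp [length_g, ih]; ring

theorem count_flatMap_g (v : List A) (x : A) : (v.flatMap g).count x = 6 * v.length := by
  induction v with
  | nil => rfl
  | cons y v ih =>
    have : (g y).count x = 6 := by cases x <;> cases y <;> decide
    simp [List.count_append, ih, this]; ring

theorem good_of_mem {s : List S} (hs : s ∈ linkingWords) : good s = true :=
  List.all_eq_true.mp all_good s hs

theorem decodeEnd_link {s : List S} (hs : s ∈ linkingWords) :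
    decodeEnd A.a A.b (f s) = (A.a, A.b) := by
  have h := good_of_mem hs
  simp only [good, Bool.and_eq_true, decide_eq_true_eq] at h
  exact h.2.1

theorem isLevel_append {s : List S} (hs : s ∈ linkingWords) (v : List A) :
    IsLevel (v.flatMap g ++ link s : Cycle A) := by
  have h := good_of_mem hs
  simp only [good, Bool.and_eq_true, decide_eq_true_eq] at h
  obtain ⟨-, -, ⟨⟨⟨⟨h1, h2⟩, h3⟩, h4⟩, h5⟩, h6⟩ := h
  intro x y
  simp only [Cycle.coe_toMultiset, Multiset.coe_count, List.count_append, count_flatMap_g]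
  cases x <;> cases y <;> omega

theorem isLinked {v : List A} (hv : CircularSquareFree (v : Cycle A)) (hp : [A.a] <+: v)
    (hsuf : [A.b] <:+ v) {s : List S} (hs : s ∈ linkingWords) :
    IsLinked (cyc (link s ++ v.flatMap g)) s
      (fun m => if m = -1 then A.b else if m = v.length then A.a else v.getD m.toNat A.a)
      (link s).length v.length := by
  have hg := good_of_mem hs
  simp only [good, Bool.and_eq_true] at hg
  obtain ⟨v₁, hv₁⟩ := hp
  obtain ⟨v₂, hv₂⟩ := hsuf
  have h0 : v.getD 0 A.a = A.a := by rw [← hv₁]; rfl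
  have hlast : v.getD (v.length - 1) A.a = A.b := by rw [← hv₂]; simp
  have h2 : 2 ≤ v.length := by
    have h1 : 1 ≤ v.length := by rw [← hv₁]; simp
    by_contra hc
    rw [show v.length - 1 = 0 by omega, h0] at hlast
    cases hlast
  have hV (m : ℤ) (hm : 0 ≤ m) (hm' : m < v.length) :
      (if m = -1 then A.b else if m = v.length then A.a else v.getD m.toNat A.a) =
        v.getD m.toNat A.a := by
    rw [if_neg (by omega), if_neg (by omega)]
  refine ⟨hg.1, by omega, rfl, ?_, ?_, fun m hm hm' => ?_, ?_, ?_, ?_, ?_, fun m hm hm' => ?_,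
    fun i q hi hq hiq => ?_⟩
  · have := cyc_periodic (link s ++ v.flatMap g)
    rw [List.length_append, length_flatMap_g] at this
    exact_mod_cast this
  · simpa using seg_cyc_append [] (link s) (v.flatMap g)
  · rw [hV m hm hm']
    lift m to ℕ using hm
    have hm' : m < v.length := by exact_mod_cast hm'
    have h3 : v.flatMap g = (v.take m).flatMap g ++ (g (v.getD m A.a) ++
        (v.drop (m + 1)).flatMap g) := by
      rw [List.getD_eq_getElem _ _ hm', ← List.flatMap_cons, ← List.drop_eq_getElem_cons,
        ← List.flatMap_append, List.take_append_drop]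
    rw [h3, ← List.append_assoc]
    have h4 := seg_cyc_append (link s ++ (v.take m).flatMap g) (g (v.getD m A.a))
      ((v.drop (m + 1)).flatMap g)
    rw [length_g, List.length_append, length_flatMap_g, List.length_take, min_eq_left hm'.le] at h4
    exact_mod_cast h4
  · rw [hV 0 le_rfl (by omega)]
    exact h0
  · rw [hV _ (by omega) (by omega), ← hlast]
    congr 1; omega
  · simp
  · rw [if_neg (by omega), if_pos rfl]
  · rcases hm.eq_or_lt with rfl | hm0
    · rw [if_pos rfl, hV _ (by omega) (by omega)]
      rw [show ((-1 : ℤ) + 1).toNat = 0 from rfl, h0]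
      decide
    · rw [hV m (by omega) hm']
      rcases (Int.add_one_le_of_lt hm').eq_or_lt with h3 | h3
      · rw [if_neg (by omega), if_pos h3, show m.toNat = v.length - 1 by omega, hlast]
        decide
      · rw [hV _ (by omega) h3]
        obtain ⟨k, hk, hne⟩ := apply_ne_of_circularSquareFree hv (i := m.toNat) (q := 1) le_rfl
          (by omega)
        rw [Nat.lt_one_iff.mp hk] at hne
        rwa [show (m + 1).toNat = m.toNat + 1 + 0 by omega]
  · obtain ⟨k, hk, hne⟩ := apply_ne_of_circularSquareFree hv (i := i.toNat) (q := q.toNat)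
      (by omega) (by omega)
    refine ⟨k, by omega, by omega, ?_⟩
    rw [hV _ (by omega) (by omega), hV _ (by omega) (by omega)]
    rwa [show (i + k).toNat = i.toNat + k by omega,
      show (i + q + k).toNat = i.toNat + q.toNat + k by omega]

theorem circularSquareFree_append {v : List A} (hv : CircularSquareFree (v : Cycle A))
    (hp : [A.a] <+: v) (hsuf : [A.b] <:+ v) {s : List S} (hs : s ∈ linkingWords) :
    CircularSquareFree (v.flatMap g ++ link s : Cycle A) := by
  rw [show ((v.flatMap g ++ link s : List A) : Cycle A) = (link s ++ v.flatMap g : List A) from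
    Cycle.coe_eq_coe.mpr List.isRotated_append]
  refine circularSquareFree_of_seg_ne fun i p hp1 hN =>
    (isLinked hv hp hsuf hs).seg_ne i hp1 ?_
  rw [List.length_append, length_flatMap_g] at hN
  exact_mod_cast hN

/-! ### Pansiot encodings -/

theorem third_eq {x y z : A} (hxy : x ≠ y) (hxz : x ≠ z) (hyz : y ≠ z) : third x y = z := by
  revert hxy hxz hyz; cases x <;> cases y <;> cases z <;> decide

theorem third_ne_left {x y : A} (hxy : x ≠ y) : x ≠ third x y := by
  revert hxy; cases x <;> cases y <;> decide

theorem third_ne_right {x y : A} (hxy : x ≠ y) : y ≠ third x y := by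
  revert hxy; cases x <;> cases y <;> decide

theorem third_self (x : A) : third x x = x := by cases x <;> rfl

/-- The default `third x x = x` makes this hold for equal letters too. -/
theorem map_next (π : Equiv.Perm A) (x y : A) (u : B) :
    next (π x) (π y) u = π (next x y u) := by
  unfold next
  split_ifs
  · rfl
  · by_cases h : x = y
    · rw [h, third_self, third_self]
    · exact third_eq (π.injective.ne h) (π.injective.ne (third_ne_left h))
        (π.injective.ne (third_ne_right h))

theorem map_decode (π : Equiv.Perm A) (x y : A) (u : List B) :
    decode (π x) (π y) u = (decode x y u).map π := by
  induction u generalizing x y with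
  | nil => rfl
  | cons b u ih => simp [decode, map_next, ih]

theorem next_eq_left_iff {x y : A} (h : x ≠ y) (u : B) : x = next x y u ↔ u = 0 := by
  unfold next
  split_ifs with hu
  · simp [hu]
  · simp [hu, third_ne_left h]

theorem decode_eq_map (u : List B) (q : ℕ → A)
    (hq : ∀ i (hi : i < u.length), q (i + 2) = next (q i) (q (i + 1)) u[i]) :
    decode (q 0) (q 1) u = (List.range u.length).map q := by
  induction u generalizing q with
  | nil => rfl
  | cons b u ih =>
    have h0 := hq 0 (by simp)
    have h1 := ih (fun i => q (i + 1)) fun i hi => hq (i + 1) (by simpa using hi)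
    simp only [zero_add, List.getElem_cons_zero, Nat.reduceAdd] at h0 h1
    rw [decode, ← h0, h1, List.length_cons, List.range_succ_eq_map]
    simp [Function.comp_def]

theorem getD_decode (x y : A) (u : List B) :
    let D := decode x y u ++ [(decodeEnd x y u).1, (decodeEnd x y u).2]
    D.getD 0 A.a = x ∧ D.getD 1 A.a = y ∧ ∀ i (hi : i < u.length),
      D.getD (i + 2) A.a = next (D.getD i A.a) (D.getD (i + 1) A.a) u[i] := by
  induction u generalizing x y with
  | nil => simp [decode, decodeEnd]
  | cons b u ih =>
    obtain ⟨h0, h1, h2⟩ := ih y (next x y b)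
    refine ⟨rfl, h0, fun i hi => ?_⟩
    cases i with
    | zero =>
      rw [zero_add, zero_add]
      exact h1.trans (congrArg (fun z => next x z b) h0.symm)
    | succ i => exact h2 i (by simpa using hi)

theorem length_pansiotWord (z : List A) : (pansiotWord z).length = z.length := by
  simp [pansiotWord]

theorem pansiotWord_rotate (z : List A) (k : ℕ) :
    pansiotWord (z.rotate k) = (pansiotWord z).rotate k := by
  refine List.ext_getElem (by simp [length_pansiotWord]) fun i hi hi' => ?_
  simp only [pansiotWord, List.getElem_ofFn, List.getElem_rotate, List.get_eq_getElem,
    List.length_rotate, List.length_ofFn]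
  congr 3
  simp only [Nat.mod_add_mod, Fin.val_cast]
  congr 1; ring

theorem isCircularFactor_pair (z : List A) {i : ℕ} (h2 : 2 ≤ z.length) :
    IsCircularFactor [z.getD (i % z.length) A.a, z.getD ((i + 1) % z.length) A.a]
      (z : Cycle A) := by
  have h (j : ℕ) : cyc z j = z.getD (j % z.length) A.a := by
    rw [cyc]; norm_cast
  refine ⟨z.rotate i, Cycle.coe_eq_coe.mpr (List.IsRotated.symm ⟨i, rfl⟩), [],
    seg (cyc z) (i + 2) (z.length - 2), ?_⟩
  rw [← seg_cyc_rotate]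
  obtain ⟨k, hk⟩ := Nat.exists_eq_add_of_le h2
  rw [hk, seg_add, show 2 + k - 2 = k by omega, ← hk, ← h, ← h]
  simp [seg, List.range_succ]

/-- Adjacent letters differ, so two letters and an encoding bit determine the next letter. -/
theorem eq_decode_pansiotWord {z : List A} (h2 : 2 ≤ z.length)
    (hz : ∀ x : A, ¬ IsCircularFactor [x, x] (z : Cycle A)) :
    z.getD 0 A.a ≠ z.getD 1 A.a ∧
      z = decode (z.getD 0 A.a) (z.getD 1 A.a) (pansiotWord z) := by
  have hne (i : ℕ) : z.getD (i % z.length) A.a ≠ z.getD ((i + 1) % z.length) A.a := fun he => by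
    have := isCircularFactor_pair z (i := i) h2
    rw [he] at this
    exact hz _ this
  have h0 : 0 % z.length = 0 := Nat.zero_mod _
  have h1 : 1 % z.length = 1 := Nat.mod_eq_of_lt h2
  constructor
  · simpa only [h0, zero_add, h1] using hne 0
  · have h := decode_eq_map (pansiotWord z) (fun i => z.getD (i % z.length) A.a) fun i hi => by
      rw [length_pansiotWord] at hi
      have e : (pansiotWord z)[i]'(by rwa [length_pansiotWord]) =
          if z.getD (i % z.length) A.a = z.getD ((i + 2) % z.length) A.a then 0 else 1 := by
        rw [Nat.mod_eq_of_lt hi, List.getD_eq_getElem _ _ hi,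
          List.getD_eq_getElem _ _ (Nat.mod_lt _ (by omega))]
        simp [pansiotWord]
      rw [e, next]
      split_ifs with h3 h4 h4
      · exact h3.symm
      · exact absurd rfl h4
      · simp at h4
      · exact (third_eq (hne i) h3 (hne (i + 1))).symm
    simp only [h0, h1] at h
    rw [h, length_pansiotWord]
    refine List.ext_getElem (by simp) fun i hi hi' => ?_
    simp [Nat.mod_eq_of_lt hi, hi]

/-- Returning to the initial pair `x y` is what makes the linear decoding consistent at the
wrap-around. -/
theorem pansiotWord_decode {x y : A} {u : List B} (hu : 2 ≤ u.length)
    (he : decodeEnd x y u = (x, y))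
    (hz : ∀ x' : A, ¬ IsCircularFactor [x', x'] (decode x y u : Cycle A)) :
    pansiotWord (decode x y u) = u := by
  obtain ⟨h0, h1, h2⟩ := getD_decode x y u
  rw [he] at h0 h1 h2
  set z := decode x y u
  have hl : z.length = u.length := length_decode x y u
  have hD (i : ℕ) (hi : i < u.length) : (z ++ [x, y]).getD i A.a = z.getD i A.a :=
    List.getD_append _ _ _ _ (by omega)
  have hmod (i : ℕ) (hi : i < u.length + 2) :
      (z ++ [x, y]).getD i A.a = z.getD (i % z.length) A.a := by
    rcases lt_or_ge i u.length with h | h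
    · rw [hD i h, hl, Nat.mod_eq_of_lt h]
    · obtain ⟨j, rfl⟩ := Nat.exists_eq_add_of_le h
      rw [hl, Nat.add_mod_left, Nat.mod_eq_of_lt (by omega), ← hD j (by omega),
        List.getD_append_right _ _ _ _ (by omega), hl, Nat.add_sub_cancel_left]
      have : j < 2 := by omega
      interval_cases j
      · exact h0.symm
      · exact h1.symm
  refine List.ext_getElem (by rw [length_pansiotWord, hl]) fun i hi hi' => ?_
  have hne : z.getD (i % z.length) A.a ≠ z.getD ((i + 1) % z.length) A.a := fun he => by
    have := isCircularFactor_pair z (i := i) (by omega)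
    rw [he] at this
    exact hz _ this
  have e : (pansiotWord z)[i] =
      if z.getD (i % z.length) A.a = z.getD ((i + 2) % z.length) A.a then 0 else 1 := by
    rw [Nat.mod_eq_of_lt (by omega), List.getD_eq_getElem _ _ (by omega),
      List.getD_eq_getElem _ _ (Nat.mod_lt _ (by omega))]
    simp [pansiotWord]
  have h3 := h2 i hi'
  rw [hmod _ (by omega), hmod _ (by omega), hmod _ (by omega)] at h3
  rw [e, h3]
  simp only [next_eq_left_iff hne]
  split_ifs with h4
  · exact h4.symm
  · exact (Fin.eq_one_of_ne_zero _ h4).symm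

theorem exists_perm {x y : A} (h : x ≠ y) : ∃ π : Equiv.Perm A, π A.a = x ∧ π A.b = y := by
  refine ⟨(Equiv.swap A.a x).trans (Equiv.swap (Equiv.swap A.a x A.b) y), ?_, by simp⟩
  rw [Equiv.trans_apply, Equiv.swap_apply_left]
  refine Equiv.swap_apply_of_ne_of_ne (fun he => ?_) h
  have : Equiv.swap A.a x A.a = Equiv.swap A.a x A.b := by rw [Equiv.swap_apply_left]; exact he
  exact absurd ((Equiv.swap A.a x).injective this) (by decide)

theorem decode_f_append {v : List A} {s : List S} (hs : s ∈ linkingWords) :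
    decode A.a A.b (f (h v ++ s)) = v.flatMap g ++ link s ∧
      decodeEnd A.a A.b (f (h v ++ s)) = (A.a, A.b) := by
  rw [f_append, decode_append, decodeEnd_append, (decode_f_h v).1, (decode_f_h v).2]
  exact ⟨rfl, decodeEnd_link hs⟩

end LevelWords

/-! ### The corollary -/

theorem mainTheorem6 (v : List LevelWords.A)
    (hv : LevelWords.CircularSquareFree (v : Cycle LevelWords.A))
    (hprefix : [LevelWords.A.a] <+: v) (hsuffix : [LevelWords.A.b] <:+ v)
    (w : List LevelWords.S) (hw : w = LevelWords.h v)
    (s : List LevelWords.S) (hs : s ∈ LevelWords.linkingWords) :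
    (∃ Z : Cycle LevelWords.A,
      LevelWords.IsCircularPansiotEncoding (LevelWords.f (w ++ s) : Cycle LevelWords.B) Z) ∧
    ∀ Z : Cycle LevelWords.A,
      LevelWords.IsCircularPansiotEncoding (LevelWords.f (w ++ s) : Cycle LevelWords.B) Z →
        LevelWords.CircularSquareFree Z ∧ LevelWords.IsLevel Z ∧
        Z.length = (LevelWords.f w).length + (LevelWords.f s).length := by
  open LevelWords in
  subst hw
  obtain ⟨hdec, hend⟩ := decode_f_append (v := v) hs
  have hsf := circularSquareFree_append hv hprefix hsuffix hs
  have hlen : 2 ≤ (f (h v ++ s)).length := by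
    have h1 := (isLinked hv hprefix hsuffix hs).checks.1
    have h2 := length_decode A.a A.b (f s)
    rw [f_append, List.length_append, ← h2]
    have : (link s).length = (decode A.a A.b (f s)).length := rfl
    omega
  constructor
  · have hxx (x : A) : ¬ IsCircularFactor [x, x] (decode A.a A.b (f (h v ++ s)) : Cycle A) := by
      rw [hdec]
      exact hsf [x] (by simp)
    refine ⟨decode A.a A.b (f (h v ++ s)), ?_, hxx, _, rfl, ?_⟩
    · rw [Cycle.length_coe, length_decode]
      exact hlen
    · rw [pansiotWord_decode hlen hend hxx]
  · rintro Z ⟨h2, hxx, z, rfl, hz⟩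
    -- Rotating `z` makes its encoding equal to `f (h v ++ s)` as a word; then it is the standard
    -- decoding up to the permutation sending `a`, `b` to its first two letters.
    obtain ⟨k, hk⟩ := (Cycle.coe_eq_coe.mp hz).symm
    rw [← pansiotWord_rotate] at hk
    have hzr : (z : Cycle A) = (z.rotate k : List A) := Cycle.coe_eq_coe.mpr ⟨k, rfl⟩
    rw [hzr] at h2 hxx ⊢
    obtain ⟨hne, heq⟩ := eq_decode_pansiotWord h2 hxx
    obtain ⟨π, ha, hb⟩ := exists_perm hne
    rw [hk, ← ha, ← hb, map_decode, hdec] at heq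
    have hl : (z.rotate k).length = (f (h v)).length + (f s).length := by
      rw [← length_pansiotWord, hk, f_append, List.length_append]
    refine ⟨?_, ?_, hl⟩
    · rw [heq]
      exact hsf.map π
    · rw [heq]
      exact (isLevel_append hs v).map π
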